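/- Fix a finite alphabet $\Sigma$. Formulas are quantifier-free: Boolean combinations (by $\neg,\wedge,\vee,\Rightarrow,\Leftrightarrow$) of atoms in string variables $x_1,x_2,\dots$ ranging over $\Sigma^*$. In the theory $\mathsf{WE}+\mathsf{REG}$ the atoms are word equations $s=t$ and membership constraints $s\in R$, where $s,t$ are concatenations of variables and letters of $\Sigma$ and $R\subseteq\Sigma^*$ is regular. In the theory $\mathsf{CF}$ the atoms are only the membership constraints $s\in D$, where $s$ is a single variable or a constant word in $\Sigma^*$ and $D\subseteq\Sigma^*$ is deterministic context-free. The language expressed by a variable $x$ occurring in a formula $f$ is the set of all $w\in\Sigma^*$ for which some assignment with $x\mapsto w$ satisfies $f$; a language is expressible in a theory if it is expressed by some variable occurring in some formula of the theory. (1) Let $a,b,c\in\Sigma$ be distinct letters and let $L=\{wcw \mid w\in\{a,b\}^*\}$. Then $L$ is expressible in $\mathsf{WE}+\mathsf{REG}$ over $\Sigma$, but $L$ is not expressible in $\mathsf{CF}$ over $\Sigma$; moreover $L$ is not an intersection of finitely many context-free languages over $\Sigma$. (2) A language over $\Sigma$ is expressible in $\mathsf{CF}$ over $\Sigma$ if and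 only if it belongs to the Boolean closure of the deterministic context-free languages over $\Sigma$ (the smallest class that contains them and is closed under union, intersection and complement in $\Sigma^*$). -/

import Mathlib

namespace StringLogic

universe u

/-! ### Deterministic pushdown automata -/

/-- A deterministic pushdown automaton with input alphabet `α`, state set `Q` and stack alphabet
`Γ`. `δ q none Z` is the move on the empty word and `δ q (some a) Z` the move that reads `a`, in
state `q` with `Z` on top of the stack; a move replaces `Z` by a word over `Γ`
(its first letter becomes the new top) and changes the state. -/
structure DPDA (α : Type u) (Q Γ : Type) where
  /-- The transition function: in each situation there is at most one move. -/
  δ : Q → Option α → Γ → Option (Q × List Γ)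
  /-- If a move on the empty word is possible, then no move that reads a letter is. -/
  det : ∀ q Z, δ q none Z ≠ none → ∀ a, δ q (some a) Z = none
  /-- The initial state. -/
  start : Q
  /-- The initial stack symbol. -/
  bottom : Γ
  /-- The final states. -/
  accept : Set Q

/-- One move between instantaneous descriptions (state, unread input, stack). -/
inductive DPDA.Step {α : Type u} {Q Γ : Type} (M : DPDA α Q Γ) :
    Q × List α × List Γ → Q × List α × List Γ → Prop
  | eps {q p : Q} {w : List α} {Z : Γ} {g s : List Γ} (h : M.δ q none Z = some (p, g)) :
      DPDA.Step M (q, w, Z :: s) (p, w, g ++ s)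
  | read {q p : Q} {a : α} {w : List α} {Z : Γ} {g s : List Γ}
      (h : M.δ q (some a) Z = some (p, g)) :
      DPDA.Step M (q, a :: w, Z :: s) (p, w, g ++ s)

/-- The language accepted by final state: the whole input has been read and the state is final,
whatever the stack. -/
def DPDA.language {α : Type u} {Q Γ : Type} (M : DPDA α Q Γ) : Language α :=
  {w | ∃ p ∈ M.accept, ∃ s : List Γ,
    Relation.ReflTransGen M.Step (M.start, w, [M.bottom]) (p, [], s)}

/-- Deterministic context-free languages. -/
def IsDCF {α : Type u} (L : Language α) : Prop :=
  ∃ (Q Γ : Type) (_ : Finite Q) (_ : Finite Γ) (M : DPDA α Q Γ), M.language = L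

/-! ### Quantifier-free formulas over strings -/

/-- String terms with concatenation: words over the string variables `x₀, x₁, …` (`Sum.inl`) and
the letters (`Sum.inr`). -/
abbrev StrTerm (α : Type u) : Type u := List (ℕ ⊕ α)

/-- Basic string terms: a single variable, or a constant word. -/
def StrTerm.IsBasic {α : Type u} (s : StrTerm α) : Prop :=
  (∃ x : ℕ, s = [Sum.inl x]) ∨ ∃ w : List α, s = w.map Sum.inr

/-- The value of a string term under a substitution of words for the variables. -/
def StrTerm.eval {α : Type u} (h : ℕ → List α) (s : StrTerm α) : List α :=
  s.flatMap (Sum.elim h fun a => [a])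

/-- Quantifier-free formulas: Boolean combinations of language membership constraints `s ∈ L` and
word equations `s = t`. -/
inductive Formula (α : Type u) : Type u
  | mem (s : StrTerm α) (L : Language α)
  | eq (s t : StrTerm α)
  | not (f : Formula α)
  | and (f g : Formula α)
  | or (f g : Formula α)
  | imp (f g : Formula α)
  | iff (f g : Formula α)

/-- Truth of a formula under a substitution of words for the variables. -/
def Formula.Holds {α : Type u} (h : ℕ → List α) : Formula α → Prop
  | .mem s L => s.eval h ∈ L
  | .eq s t => s.eval h = t.eval h
  | .not f => ¬ f.Holds h
  | .and f g => f.Holds h ∧ g.Holds h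
  | .or f g => f.Holds h ∨ g.Holds h
  | .imp f g => f.Holds h → g.Holds h
  | .iff f g => (f.Holds h ↔ g.Holds h)

/-- The variable `x` occurs in a formula. -/
def Formula.Occurs {α : Type u} (x : ℕ) : Formula α → Prop
  | .mem s _ => Sum.inl x ∈ s
  | .eq s t => Sum.inl x ∈ s ∨ Sum.inl x ∈ t
  | .not f => f.Occurs x
  | .and f g => f.Occurs x ∨ g.Occurs x
  | .or f g => f.Occurs x ∨ g.Occurs x
  | .imp f g => f.Occurs x ∨ g.Occurs x
  | .iff f g => f.Occurs x ∨ g.Occurs x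

/-- The language expressed by the variable `x` in the formula `f`. -/
def Formula.expressed {α : Type u} (f : Formula α) (x : ℕ) : Language α :=
  {w | ∃ h : ℕ → List α, h x = w ∧ f.Holds h}

/-- The formulas all of whose membership atoms `s ∈ L` satisfy `P s L` and all of whose word
equations `s = t` satisfy `E s t`. -/
def Formula.AtomsIn {α : Type u} (P : StrTerm α → Language α → Prop)
    (E : StrTerm α → StrTerm α → Prop) : Formula α → Prop
  | .mem s L => P s L
  | .eq s t => E s t
  | .not f => f.AtomsIn P E
  | .and f g => f.AtomsIn P E ∧ g.AtomsIn P E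
  | .or f g => f.AtomsIn P E ∧ g.AtomsIn P E
  | .imp f g => f.AtomsIn P E ∧ g.AtomsIn P E
  | .iff f g => f.AtomsIn P E ∧ g.AtomsIn P E

/-- The theory of word equations and regular membership constraints, with concatenation. -/
def theoryWEREG (α : Type u) : Set (Formula α) :=
  {f | f.AtomsIn (fun _ L => L.IsRegular) (fun _ _ => True)}

/-- The theory of deterministic context-free membership constraints on basic string terms: no word
equations, no concatenation. -/
def theoryCF (α : Type u) : Set (Formula α) :=
  {f | f.AtomsIn (fun s L => s.IsBasic ∧ IsDCF L) (fun _ _ => False)}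

/-- `L` is the language expressed by some variable that occurs in some formula of the theory. -/
def Expressible {α : Type u} (T : Set (Formula α)) (L : Language α) : Prop :=
  ∃ f ∈ T, ∃ x : ℕ, f.Occurs x ∧ f.expressed x = L

/-- The language of all `w c w` with `w` a word over the letters `a` and `b`. -/
def copyLang {α : Type u} (a b c : α) : Language α :=
  {v | ∃ w : List α, (∀ s ∈ w, s = a ∨ s = b) ∧ v = w ++ [c] ++ w}

end StringLogic

namespace StringLogic

universe u

/-! ### Binary decompositions of words -/

/-! A context-free grammar or a DPDA cuts each accepted word by a binary tree whose nodes carry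
finitely many labels, and a factor at a node may be replaced by any word of the same length with the
same label. Languages with such trees (`IsSplittable`) cannot compare two distant copies of a word,
and neither can finitely many of them together.

For `w c w` and `k` splittable languages, cut `w` into `k + 1` blocks of `l` bits. Descending a tree
to the cut that parts two intervals (`Splits.exists_node`) shows that each language fails on at most
one block to have a node containing exactly one of its two copies, so some block is good for all `k`
languages. Labels and positions of the nodes take polynomially many values in `l`, a block `2 ^ l`;
hence two words differ only in a common good block and have equal node data. Exchanging factors puts
the mixed word `u c v` into every language, although `u ≠ v` (`copyLang_ne_inter`).

Splittability comes from derivation trees (`IsContextFree.isSplittable`) and from runs of a DPDA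
(`IsDCF.isSplittable`). The latter treats complements too, so the whole Boolean closure consists of
finite intersections of splittable languages. Finally, fixing all variables but one in a formula of
`theoryCF` leaves finitely many Boolean combinations of its languages, and the expressed language is
their union (`mem_closure_of_expressible`). -/

/-- `Splits V K z`: the word `z` of `K` has a binary decomposition tree whose nodes are labelled by
languages in `V`, such that the word at a node may be exchanged for any other word of the same
length in the language at that node. -/
inductive Splits {α : Type u} (V : Set (Set (List α))) : Set (List α) → List α → Prop
  | short {K : Set (List α)} {z : List α} (hK : K ∈ V) (hz : z ∈ K) (h : z.length ≤ 1) :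
      Splits V K z
  | sub {K K' : Set (List α)} {z : List α} (hK : K ∈ V) (h' : Splits V K' z)
      (h : ∀ y ∈ K', y.length = z.length → y ∈ K) : Splits V K z
  | append {K K₁ K₂ : Set (List α)} {z₁ z₂ : List α} (hK : K ∈ V)
      (h₁ : Splits V K₁ z₁) (h₂ : Splits V K₂ z₂)
      (hl : ∀ y ∈ K₁, y.length = z₁.length → y ++ z₂ ∈ K)
      (hr : ∀ y ∈ K₂, y.length = z₂.length → z₁ ++ y ∈ K) : Splits V K (z₁ ++ z₂)

theorem Splits.mem_nodes {α : Type u} {V : Set (Set (List α))} {K : Set (List α)} {z : List α}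
    (h : Splits V K z) : K ∈ V := by
  cases h <;> assumption

theorem Splits.mem {α : Type u} {V : Set (Set (List α))} {K : Set (List α)} {z : List α}
    (h : Splits V K z) : z ∈ K := by
  induction h with
  | short _ hz => exact hz
  | sub _ _ h ih => exact h _ ih rfl
  | append _ _ _ hl _ ih₁ _ => exact hl _ ih₁ rfl

theorem Splits.mono {α : Type u} {V W : Set (Set (List α))} (hVW : V ⊆ W) {K : Set (List α)}
    {z : List α} (h : Splits V K z) : Splits W K z := by
  induction h with
  | short hK hz h => exact .short (hVW hK) hz h
  | sub hK _ h ih => exact .sub (hVW hK) ih h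
  | append hK _ _ hl hr ih₁ ih₂ => exact .append (hVW hK) ih₁ ih₂ hl hr

/-- A language with decomposition trees over finitely many node languages. -/
def IsSplittable {α : Type u} (L : Language α) : Prop :=
  ∃ V : Set (Set (List α)), V.Finite ∧ ∀ z ∈ L, Splits V {w | w ∈ L} z

/-- One new label suffices: placed above an existing tree, a `sub` node needs only an inclusion. -/
theorem IsSplittable.sup {α : Type u} {L M : Language α} (hL : IsSplittable L)
    (hM : IsSplittable M) : IsSplittable (L ⊔ M) := by
  obtain ⟨V, hV, hVL⟩ := hL
  obtain ⟨W, hW, hWM⟩ := hM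
  refine ⟨insert {w | w ∈ L ⊔ M} (V ∪ W), (hV.union hW).insert _, ?_⟩
  rintro z (hz | hz)
  · exact .sub (Set.mem_insert _ _)
      ((hVL z hz).mono (Set.subset_union_left.trans (Set.subset_insert _ _)))
      fun y hy _ => Or.inl hy
  · exact .sub (Set.mem_insert _ _)
      ((hWM z hz).mono (Set.subset_union_right.trans (Set.subset_insert _ _)))
      fun y hy _ => Or.inr hy

/-- Let `[a₁, a₂)` and `[b₁, b₂)` be intervals of positions in `z`, the first before the second.
Some node contains the first and ends before the end of the second, or contains the second and
begins after the beginning of the first. -/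
theorem Splits.exists_node {α : Type u} {V : Set (Set (List α))} {K : Set (List α)} {z : List α}
    (h : Splits V K z) (a₁ a₂ b₁ b₂ : ℕ) (ha : a₁ < a₂) (hab : a₂ ≤ b₁) (hb : b₁ < b₂)
    (hz : b₂ ≤ z.length) :
    ∃ X ∈ V, ∃ p q r : List α, z = p ++ q ++ r ∧ q ∈ X ∧
      (∀ y ∈ X, y.length = q.length → p ++ y ++ r ∈ K) ∧
      ((p.length ≤ a₁ ∧ a₂ ≤ p.length + q.length ∧ p.length + q.length < b₂) ∨
       (a₁ < p.length ∧ p.length ≤ b₁ ∧ b₂ ≤ p.length + q.length)) := by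
  induction h generalizing a₁ a₂ b₁ b₂ with
  | short _ _ h => omega
  | sub _ _ h ih =>
    obtain ⟨X, hX, p, q, r, rfl, hq, hy, hpq⟩ := ih a₁ a₂ b₁ b₂ ha hab hb hz
    exact ⟨X, hX, p, q, r, rfl, hq, fun y hyX hl => h _ (hy y hyX hl) (by simp [hl]), hpq⟩
  | @append K K₁ K₂ z₁ z₂ hK h₁ h₂ hl hr ih₁ ih₂ =>
    rw [List.length_append] at hz
    by_cases c₁ : b₂ ≤ z₁.length
    · obtain ⟨X, hX, p, q, r, rfl, hq, hy, hpq⟩ := ih₁ a₁ a₂ b₁ b₂ ha hab hb c₁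
      refine ⟨X, hX, p, q, r ++ z₂, by simp, hq, fun y hyX hlen => ?_, hpq⟩
      simpa using hl _ (hy y hyX hlen) (by simp [hlen])
    by_cases c₂ : z₁.length ≤ a₁
    · obtain ⟨X, hX, p, q, r, rfl, hq, hy, hpq⟩ := ih₂ (a₁ - z₁.length) (a₂ - z₁.length)
        (b₁ - z₁.length) (b₂ - z₁.length) (by omega) (by omega) (by omega) (by omega)
      refine ⟨X, hX, z₁ ++ p, q, r, by simp, hq, fun y hyX hlen => ?_, ?_⟩
      · simpa using hr _ (hy y hyX hlen) (by simp [hlen])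
      · rw [List.length_append]
        omega
    -- The cut now lies strictly between `a₁` and `b₂`: either the left child contains the first
    -- interval, or the cut falls inside that interval and the right child contains the second.
    by_cases c₃ : a₂ ≤ z₁.length
    · exact ⟨K₁, h₁.mem_nodes, [], z₁, z₂, by simp, h₁.mem, fun y hy hlen => by
        simpa using hl y hy hlen, Or.inl (by simp; omega)⟩
    · exact ⟨K₂, h₂.mem_nodes, z₁, z₂, [], by simp, h₂.mem, fun y hy hlen => by
        simpa using hr y hy hlen, Or.inr (by omega)⟩

/-! ### The copy language is not a finite intersection of splittable languages -/

theorem exists_mul_pow_lt_two_pow (A d : ℕ) : ∃ l : ℕ, 0 < l ∧ A * l ^ d < 2 ^ l := by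
  have h := (tendsto_pow_const_div_const_pow_of_one_lt d (one_lt_two : (1 : ℝ) < 2))
  have h2 := h.eventually (gt_mem_nhds (show (0 : ℝ) < 1 / (A + 1) by positivity))
  obtain ⟨l, hl, hpos⟩ := (h2.and (Filter.eventually_gt_atTop 0)).exists
  refine ⟨l, hpos, ?_⟩
  rw [div_lt_div_iff₀ (by positivity) (by positivity), one_mul] at hl
  have : ((A * l ^ d : ℕ) : ℝ) < ((2 ^ l : ℕ) : ℝ) := by
    push_cast
    have : (0 : ℝ) ≤ (l : ℝ) ^ d := by positivity
    nlinarith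
  exact_mod_cast this

theorem exchange_getElem? {α : Type u} {p q r p' q' r' : List α} (hp : p.length = p'.length)
    (hq : q.length = q'.length) (t : ℕ) :
    (p' ++ q ++ r')[t]? = if p.length ≤ t ∧ t < p.length + q.length then (p ++ q ++ r)[t]?
      else (p' ++ q' ++ r')[t]? := by
  simp only [List.getElem?_append, List.length_append]
  split_ifs <;> first | rfl | omega | (congr 1; omega)

theorem square_getElem? {α : Type u} (u v : List α) (c : α) (t : ℕ) :
    (u ++ [c] ++ v)[t]? = if t < u.length then u[t]? else if t = u.length then some c
      else v[t - u.length - 1]? := by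
  simp only [List.getElem?_append, List.length_append, List.length_singleton]
  split_ifs with h₁ h₂ h₃ h₄ <;> first | rfl | omega | skip
  · subst h₃; simp

/-- The window covers the differing block in the first half and stops before its copy, so it decides
the first copy only. At all other positions `u` and `v` agree. -/
theorem exchange_first {α : Type u} {u v : List α} {c : α} {s e : ℕ} (hl : u.length = v.length)
    (huv : ∀ t, t < s ∨ e ≤ t → u[t]? = v[t]?)
    {p q r p' q' r' : List α} (hu : u ++ [c] ++ u = p ++ q ++ r) (hv : v ++ [c] ++ v = p' ++ q' ++ r')
    (hp : p.length = p'.length) (hq : q.length = q'.length)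
    (h₁ : p.length ≤ s) (h₂ : e ≤ p.length + q.length)
    (h₃ : p.length + q.length ≤ s + u.length + 1) : p' ++ q ++ r' = u ++ [c] ++ v := by
  refine List.ext_getElem? fun t => ?_
  rw [exchange_getElem? hp hq (r := r), ← hu, ← hv]
  simp only [square_getElem?, ← hl]
  split_ifs with a b c d e <;> first | rfl | skip
  · exact huv _ (by omega)
  · exact (huv _ (by omega)).symm

theorem exchange_second {α : Type u} {u v : List α} {c : α} {s e : ℕ} (hl : u.length = v.length)
    (huv : ∀ t, t < s ∨ e ≤ t → u[t]? = v[t]?)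
    {p q r p' q' r' : List α} (hu : u ++ [c] ++ u = p ++ q ++ r) (hv : v ++ [c] ++ v = p' ++ q' ++ r')
    (hp : p.length = p'.length) (hq : q.length = q'.length)
    (h₁ : e ≤ p.length) (h₂ : p.length ≤ s + u.length + 1)
    (h₃ : e + u.length + 1 ≤ p.length + q.length) : p ++ q' ++ r = u ++ [c] ++ v := by
  refine List.ext_getElem? fun t => ?_
  rw [exchange_getElem? hp.symm hq.symm (r := r'), ← hu, ← hv]
  simp only [square_getElem?, ← hl, ← hp, ← hq]
  split_ifs with a b c d e <;> first | rfl | skip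
  · exact (huv _ (by omega)).symm
  · exact huv _ (by omega)

theorem eq_of_append_mem_copyLang {α : Type u} {a b c : α} {u v : List α}
    (hl : u.length = v.length) (h : u ++ [c] ++ v ∈ copyLang a b c) : u = v := by
  obtain ⟨w, -, hw⟩ := h
  have hlen := congrArg List.length hw
  simp only [List.length_append, List.length_singleton] at hlen
  rw [List.append_assoc, List.append_assoc] at hw
  obtain ⟨h₁, h₂⟩ := List.append_inj hw (by omega)
  exact h₁.trans (by simpa using h₂.symm)

/-- The letter at position `t` of the word over `a` and `b` with the given blocks of `l` bits. -/
def blockLetter {α : Type u} (a b : α) {k l : ℕ} (f : Fin k → Fin l → Bool) (t : ℕ) : α :=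
  if h : t / l < k ∧ t % l < l then bif f ⟨t / l, h.1⟩ ⟨t % l, h.2⟩ then a else b else a

/-- The word over `a` and `b` with the given blocks of `l` bits. -/
def blockWord {α : Type u} (a b : α) {k l : ℕ} (f : Fin k → Fin l → Bool) : List α :=
  (List.range (k * l)).map (blockLetter a b f)

theorem length_blockWord {α : Type u} (a b : α) {k l : ℕ} (f : Fin k → Fin l → Bool) :
    (blockWord a b f).length = k * l := by
  simp [blockWord]

theorem blockWord_letters {α : Type u} (a b : α) {k l : ℕ} (f : Fin k → Fin l → Bool) :
    ∀ s ∈ blockWord a b f, s = a ∨ s = b := by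
  intro s hs
  obtain ⟨t, -, rfl⟩ := List.mem_map.1 hs
  unfold blockLetter
  split_ifs with h
  · cases f ⟨t / l, h.1⟩ ⟨t % l, h.2⟩ <;> simp
  · exact Or.inl rfl

theorem blockWord_injective {α : Type u} {a b : α} (hab : a ≠ b) {k l : ℕ} :
    Function.Injective (blockWord a b : (Fin k → Fin l → Bool) → List α) := by
  intro f g hfg
  ext j i
  have hl : 0 < l := i.pos
  have hdiv : (j * l + i : ℕ) / l = j := by
    rw [mul_comm, Nat.mul_add_div hl, Nat.div_eq_of_lt i.2, add_zero]
  have hmod : (j * l + i : ℕ) % l = i := by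
    rw [mul_comm, Nat.mul_add_mod, Nat.mod_eq_of_lt i.2]
  have ht : (j * l + i : ℕ) < k * l := by
    have := Nat.mul_le_mul_right l (Nat.succ_le_of_lt j.2)
    have := i.2
    rw [Nat.succ_mul] at *
    omega
  have h := congrArg (fun w => w[(j * l + i : ℕ)]?) hfg
  simp only [blockWord, List.getElem?_map, List.getElem?_range ht, Option.map_some,
    Option.some.injEq, blockLetter, hdiv, hmod, j.2, i.2, and_self, dite_true, Fin.eta] at h
  revert h
  cases f j i <;> cases g j i <;> simp [hab, hab.symm]

theorem blockWord_getElem?_congr {α : Type u} (a b : α) {k l : ℕ} {f g : Fin k → Fin l → Bool}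
    (j : Fin k) (hfg : ∀ i, i ≠ j → f i = g i) (t : ℕ) (ht : t < j * l ∨ (j + 1) * l ≤ t) :
    (blockWord a b f)[t]? = (blockWord a b g)[t]? := by
  by_cases htk : t < k * l
  · simp only [blockWord, List.getElem?_map, List.getElem?_range htk, Option.map_some,
      Option.some.injEq, blockLetter]
    split_ifs with h
    · rw [hfg ⟨t / l, h.1⟩]
      rintro rfl
      have h₁ := Nat.div_mul_le_self t l
      have h₂ := Nat.lt_div_mul_add (a := t) (b := l) (by omega)
      simp only [Nat.succ_mul] at ht
      omega
    · rfl
  · rw [List.getElem?_eq_none, List.getElem?_eq_none] <;> rw [length_blockWord] <;> omega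

/-- The node of `z` with label `X`, start `m` and length `d` contains exactly one of the intervals
`[s, e)` and `[s + n, e + n)`, and is disjoint from the other: it contains the first if `β`, else
the second. -/
def Separates {α : Type u} (K : Set (List α)) (z : List α) (n s e : ℕ) (X : Set (List α))
    (m d : ℕ) (β : Bool) : Prop :=
  ∃ p q r : List α, z = p ++ q ++ r ∧ q ∈ X ∧
    (∀ y ∈ X, y.length = q.length → p ++ y ++ r ∈ K) ∧ p.length = m ∧ q.length = d ∧
    bif β then m ≤ s ∧ e ≤ m + d ∧ m + d ≤ s + n else e ≤ m ∧ m ≤ s + n ∧ e + n ≤ m + d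

/-- Of two disjoint intervals in the first half of `z`, one is separated from its copy. -/
theorem Splits.separates_or {α : Type u} {V : Set (Set (List α))} {K : Set (List α)} {z : List α}
    (h : Splits V K z) {n s₁ e₁ s₂ e₂ : ℕ} (h₁ : s₁ < e₁) (h₁₂ : e₁ ≤ s₂) (h₂ : s₂ < e₂)
    (hn : e₂ ≤ s₁ + n) (hz : e₁ + n ≤ z.length) :
    (∃ X ∈ V, ∃ m ≤ z.length, ∃ d ≤ z.length, ∃ β, Separates K z n s₁ e₁ X m d β) ∨
    (∃ X ∈ V, ∃ m ≤ z.length, ∃ d ≤ z.length, ∃ β, Separates K z n s₂ e₂ X m d β) := by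
  -- The trick is to cross the blocks: the second block is compared with the copy of the first. A
  -- node ending before the end of that copy misses the copy of the second block; one starting after
  -- the start of the second block misses the first.
  obtain ⟨X, hX, p, q, r, hz', hq, hy, ⟨hp₁, hp₂, hp₃⟩ | ⟨hp₁, hp₂, hp₃⟩⟩ :=
    h.exists_node s₂ e₂ (s₁ + n) (e₁ + n) h₂ hn (by omega) hz
  all_goals have hlen := congrArg List.length hz'; simp only [List.length_append] at hlen
  · exact Or.inr ⟨X, hX, p.length, by omega, q.length, by omega, true, p, q, r, hz', hq, hy, rfl,
      rfl, hp₁, hp₂, by omega⟩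
  · exact Or.inl ⟨X, hX, p.length, by omega, q.length, by omega, false, p, q, r, hz', hq, hy, rfl,
      rfl, by omega, hp₂, hp₃⟩

/-- A pigeonhole on blocks against languages finds a good block for each word; a second one on words
against node data finds two words to mix. -/
theorem copyLang_ne_inter {α : Type u} {a b c : α} (hab : a ≠ b) {ι : Type*} [Fintype ι]
    (L : ι → Language α) (hL : ∀ i, IsSplittable (L i))
    (h : ∀ z, z ∈ copyLang a b c ↔ ∀ i, z ∈ L i) : False := by
  classical
  choose V hV hVL using hL
  set W : Set (Set (List α)) := ⋃ i, V i with hW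
  have hWfin : W.Finite := Set.finite_iUnion hV
  have := hWfin.fintype
  have hWL : ∀ i, ∀ z ∈ L i, Splits W {w | w ∈ L i} z := fun i z hz =>
    (hVL i z hz).mono (Set.subset_iUnion V i)
  set k := Fintype.card ι with hk
  obtain ⟨l, hl, hgrowth⟩ := exists_mul_pow_lt_two_pow
    ((k + 1) * (Fintype.card W * (2 * k + 4) ^ 2 * 2) ^ k) (2 * k)
  set n := (k + 1) * l with hn
  set N := 2 * n + 1 with hN
  set z : (Fin (k + 1) → Fin l → Bool) → List α :=
    fun f => blockWord a b f ++ [c] ++ blockWord a b f with hzdef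
  have hzlen : ∀ f, (z f).length = N := fun f => by
    simp only [hzdef, List.length_append, length_blockWord, List.length_singleton]
    omega
  have hzL : ∀ f i, z f ∈ L i := fun f =>
    (h _).1 ⟨blockWord a b f, blockWord_letters a b f, rfl⟩
  have hblock : ∀ j : Fin (k + 1), (j + 1) * l ≤ n := fun j =>
    Nat.mul_le_mul_right l (Nat.succ_le_of_lt j.2)
  -- If every block failed in some language, two of the `k + 1` blocks would fail in the same one,
  -- against `separates_or`. The shift `n + 1` between copies accounts for the letter `c`.
  have hex : ∀ f, ∃ j : Fin (k + 1), ∀ i, ∃ σ : W × Fin (N + 1) × Fin (N + 1) × Bool,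
      Separates {w | w ∈ L i} (z f) (n + 1) (j * l) ((j + 1) * l) σ.1 σ.2.1 σ.2.2.1 σ.2.2.2 := by
    intro f
    by_contra! hcon
    choose i hi using hcon
    obtain ⟨j₁, j₂, hj, hij⟩ : ∃ j₁ j₂, j₁ < j₂ ∧ i j₁ = i j₂ := by
      obtain ⟨j₁, j₂, hne, hij⟩ := Fintype.exists_ne_map_eq_of_card_lt i (by simp [← hk])
      rcases lt_or_gt_of_ne hne with hlt | hlt
      · exact ⟨j₁, j₂, hlt, hij⟩
      · exact ⟨j₂, j₁, hlt, hij.symm⟩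
    have hjl : ((j₁ : ℕ) + 1) * l ≤ j₂ * l := Nat.mul_le_mul_right l hj
    have e₁ : ((j₁ : ℕ) + 1) * l = j₁ * l + l := Nat.succ_mul _ _
    have e₂ : ((j₂ : ℕ) + 1) * l = j₂ * l + l := Nat.succ_mul _ _
    have hb₁ := hblock j₁
    have hb₂ := hblock j₂
    rcases (hWL (i j₁) (z f) (hzL f _)).separates_or (n := n + 1) (s₁ := j₁ * l)
      (e₁ := (j₁ + 1) * l) (s₂ := j₂ * l) (e₂ := (j₂ + 1) * l) (by omega) hjl (by omega)
      (by omega) (by rw [hzlen]; omega) with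
      ⟨X, hX, m, hm, d, hd, β, hs⟩ | ⟨X, hX, m, hm, d, hd, β, hs⟩
    all_goals rw [hzlen] at hm hd
    · exact hi j₁ ⟨⟨X, hX⟩, ⟨m, by omega⟩, ⟨d, by omega⟩, β⟩ hs
    · exact hi j₂ ⟨⟨X, hX⟩, ⟨m, by omega⟩, ⟨d, by omega⟩, β⟩ (hij ▸ hs)
  choose J σ hσ using hex
  obtain ⟨f, g, hne, hfg⟩ := Fintype.exists_ne_map_eq_of_card_lt
    (fun f : Fin (k + 1) → Fin l → Bool => (J f, (J f).removeNth f, σ f)) (by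
      -- Positivity of `l` absorbs the additive constant, leaving a pure power of `l` in the count.
      have h₁ : N + 1 ≤ (2 * k + 4) * l := by
        rw [hN, hn]
        nlinarith
      simp only [Fintype.card_prod, Fintype.card_fun, Fintype.card_fin, Fintype.card_bool, ← hk]
      calc (k + 1) * (((2 ^ l) ^ k) * (Fintype.card W * ((N + 1) * ((N + 1) * 2))) ^ k)
          ≤ (k + 1) * (((2 ^ l) ^ k) * (Fintype.card W *
              (((2 * k + 4) * l) * (((2 * k + 4) * l) * 2))) ^ k) := by gcongr
        _ = ((k + 1) * (Fintype.card W * (2 * k + 4) ^ 2 * 2) ^ k * l ^ (2 * k)) * (2 ^ l) ^ k := by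
            rw [pow_mul l 2 k, mul_assoc (k + 1), mul_assoc (k + 1), ← mul_pow, ← mul_pow, ← mul_pow]
            congr 2
            ring
        _ < 2 ^ l * (2 ^ l) ^ k := by gcongr
        _ = (2 ^ l) ^ (k + 1) := by ring)
  simp only [Prod.mk.injEq] at hfg
  obtain ⟨hJ, hrem, hσfg⟩ := hfg
  have hoff : ∀ i, i ≠ J f → f i = g i := by
    intro i hi
    obtain ⟨x, rfl⟩ := Fin.exists_succAbove_eq hi
    rw [← hJ] at hrem
    exact congrFun hrem x
  have hlen : (blockWord a b f).length = (blockWord a b g).length := by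
    rw [length_blockWord, length_blockWord]
  have hmix : blockWord a b f ++ [c] ++ blockWord a b g ∈ copyLang a b c := by
    rw [h]
    intro i
    have hf := hσ f i
    have hg := hσ g i
    rw [← hσfg, ← hJ] at hg
    have huv := blockWord_getElem?_congr a b (J f) hoff
    have hb := hblock (J f)
    have hwl := length_blockWord a b f
    obtain ⟨p, q, r, hz, hq, hy, hp, hd, hβ⟩ := hf
    obtain ⟨p', q', r', hz', hq', hy', hp', hd', -⟩ := hg
    cases hβ' : (σ f i).2.2.2
    · rw [hβ'] at hβ
      simp only [cond_false] at hβ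
      rw [← exchange_second hlen huv hz hz' (hp.trans hp'.symm) (hd.trans hd'.symm) (by omega)
        (by omega) (by omega)]
      exact hy _ hq' (by omega)
    · rw [hβ'] at hβ
      simp only [cond_true] at hβ
      rw [← exchange_first hlen huv hz hz' (hp.trans hp'.symm) (hd.trans hd'.symm)
        (by omega) (by omega) (by omega)]
      exact hy' _ hq (by omega)
  exact hne (blockWord_injective hab (eq_of_append_mem_copyLang hlen hmix))

theorem copyLang_notMem_infClosure {α : Type u} {a b c : α} (hab : a ≠ b) :
    copyLang a b c ∉ infClosure {K : Language α | IsSplittable K} := by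
  rintro ⟨t, ht, hts, hinf⟩
  refine copyLang_ne_inter (c := c) hab (fun i : t => i.1) (fun i => hts i.2) fun z => ?_
  -- Membership becomes an inequality, so that the universal property of the infimum applies.
  have key : ∀ K : Language α, z ∈ K ↔ ({z} : Language α) ≤ K := fun K =>
    (Set.singleton_subset_iff (a := z) (s := K)).symm
  rw [key, ← hinf, Finset.le_inf'_iff]
  simp [key]

/-! ### Context-free languages are splittable -/

/-- `Yields g γ w`: the sentential form `γ` has derivation trees with yield `w`. -/
inductive Yields {α : Type u} (g : ContextFreeGrammar α) :
    List (Symbol α g.NT) → List α → Prop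
  | nil : Yields g [] []
  | terminal (t : α) {γ : List (Symbol α g.NT)} {w : List α} (h : Yields g γ w) :
      Yields g (.terminal t :: γ) (t :: w)
  | nonterminal {r : ContextFreeRule α g.NT} (hr : r ∈ g.rules) {γ : List (Symbol α g.NT)}
      {v w : List α} (hv : Yields g r.output v) (hw : Yields g γ w) :
      Yields g (.nonterminal r.input :: γ) (v ++ w)

section Grammar

variable {α : Type u} {g : ContextFreeGrammar α}

theorem Yields.append {γ δ : List (Symbol α g.NT)} {v w : List α} (hv : Yields g γ v)
    (hw : Yields g δ w) : Yields g (γ ++ δ) (v ++ w) := by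
  induction hv with
  | nil => exact hw
  | terminal t _ ih => exact .terminal t ih
  | nonterminal hr hv _ _ ih =>
    rw [List.append_assoc]
    exact .nonterminal hr hv ih

theorem Yields.exists_append {γ δ : List (Symbol α g.NT)} {w : List α} (h : Yields g (γ ++ δ) w) :
    ∃ w₁ w₂, w = w₁ ++ w₂ ∧ Yields g γ w₁ ∧ Yields g δ w₂ := by
  induction γ generalizing w with
  | nil => exact ⟨[], w, rfl, .nil, h⟩
  | cons s γ ih =>
    cases h with
    | terminal t h =>
      obtain ⟨w₁, w₂, rfl, h₁, h₂⟩ := ih h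
      exact ⟨t :: w₁, w₂, rfl, .terminal t h₁, h₂⟩
    | nonterminal hr hv hw =>
      obtain ⟨w₁, w₂, rfl, h₁, h₂⟩ := ih hw
      exact ⟨_ ++ w₁, w₂, by rw [List.append_assoc], .nonterminal hr hv h₁, h₂⟩

theorem yields_map_terminal (w : List α) : Yields g (w.map .terminal) w := by
  induction w with
  | nil => exact .nil
  | cons t w ih => exact .terminal t ih

theorem Yields.of_rewrites {r : ContextFreeRule α g.NT} (hr : r ∈ g.rules)
    {γ δ : List (Symbol α g.NT)} (h : r.Rewrites γ δ) {w : List α} (hw : Yields g δ w) :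
    Yields g γ w := by
  induction h generalizing w with
  | head s =>
    obtain ⟨w₁, w₂, rfl, h₁, h₂⟩ := hw.exists_append
    exact .nonterminal hr h₁ h₂
  | cons x _ ih =>
    cases hw with
    | terminal t h => exact .terminal t (ih h)
    | nonterminal hr' hv h => exact .nonterminal hr' hv (ih h)

theorem yields_of_derives {γ : List (Symbol α g.NT)} {w : List α}
    (h : g.Derives γ (w.map .terminal)) : Yields g γ w := by
  induction h using Relation.ReflTransGen.head_induction_on with
  | refl => exact yields_map_terminal w
  | head h _ ih =>
    obtain ⟨r, hr, hrw⟩ := h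
    exact ih.of_rewrites hr hrw

theorem Yields.derives {γ : List (Symbol α g.NT)} {w : List α} (h : Yields g γ w) :
    g.Derives γ (w.map .terminal) := by
  induction h with
  | nil => exact Relation.ReflTransGen.refl
  | terminal t _ ih => exact ih.append_left [Symbol.terminal t]
  | @nonterminal r hr γ v w _ _ ihv ihw =>
    have h₁ : g.Produces [.nonterminal r.input] r.output := ⟨r, hr, .input_output⟩
    rw [List.map_append]
    exact ((h₁.trans_derives ihv).append_right γ).trans (ihw.append_left _)

/-- Cut off the first symbol of the sentential form: yields concatenate independently, so the
exchange conditions are immediate. Taking `S` closed under sublists covers both the first symbol and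
the remainder. -/
theorem Yields.splits {V : Set (Set (List α))} {S : Set (List (Symbol α g.NT))}
    (hV : ∀ γ ∈ S, {w | Yields g γ w} ∈ V) (hsub : ∀ γ ∈ S, ∀ δ, δ.Sublist γ → δ ∈ S)
    (hout : ∀ r ∈ g.rules, r.output ∈ S) {γ : List (Symbol α g.NT)} (hγ : γ ∈ S) {w : List α}
    (h : Yields g γ w) : Splits V {w | Yields g γ w} w := by
  induction h with
  | nil => exact .short (hV _ hγ) .nil (by simp)
  | @terminal t γ w h ih =>
    refine .append (z₁ := [t]) (hV _ hγ) (.short (hV [.terminal t] (hsub _ hγ _ (by simp)))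
      (.terminal t .nil) (by simp)) (ih (hsub _ hγ _ (by simp))) ?_ ?_
    · exact fun y hy _ => Yields.append hy h
    · exact fun y hy _ => .terminal t hy
  | @nonterminal r hr γ v w hv hw ihv ihw =>
    refine .append (hV _ hγ) (.sub (hV [.nonterminal r.input] (hsub _ hγ _ (by simp)))
      (ihv (hout r hr)) ?_) (ihw (hsub _ hγ _ (by simp))) ?_ ?_
    · intro y hy _
      simpa using Yields.nonterminal hr hy .nil
    · exact fun y hy _ => Yields.append hy hw
    · exact fun y hy _ => .nonterminal hr hv hy

theorem IsContextFree.isSplittable {L : Language α} (hL : L.IsContextFree) : IsSplittable L := by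
  obtain ⟨g, rfl⟩ := hL
  set S : Set (List (Symbol α g.NT)) :=
    {γ | ∃ δ ∈ insert [.nonterminal g.initial]
      ((fun r => r.output) '' (g.rules : Set (ContextFreeRule α g.NT))),
      γ.Sublist δ} with hS
  have hfin : S.Finite := by
    have : S = ⋃ δ ∈ insert [.nonterminal g.initial]
        ((fun r => r.output) '' (g.rules : Set (ContextFreeRule α g.NT))),
        {γ | γ ∈ δ.sublists} := by
      ext γ
      simp [hS]
    rw [this]
    exact ((g.rules.finite_toSet.image _).insert _).biUnion fun δ _ => List.finite_toSet _
  set V : Set (Set (List α)) := (fun γ => {w | Yields g γ w}) '' S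
  have hSV : ∀ γ ∈ S, {w | Yields g γ w} ∈ V := fun γ hγ => ⟨γ, hγ, rfl⟩
  refine ⟨V, hfin.image _, fun z hz => ?_⟩
  have hlang : {w | w ∈ g.language} = {w | Yields g [.nonterminal g.initial] w} := by
    ext w
    exact ⟨yields_of_derives, Yields.derives⟩
  rw [hlang]
  exact Yields.splits (S := S) hSV
    (fun γ ⟨δ, hδ, h⟩ ε hε => ⟨δ, hδ, hε.trans h⟩)
    (fun r hr => ⟨_, Or.inr ⟨r, hr, rfl⟩, .refl _⟩)
    ⟨_, Set.mem_insert _ _, .refl _⟩ (yields_of_derives hz)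

end Grammar

/-! ### Deterministic context-free languages and their complements are splittable -/

namespace DPDA

variable {α : Type u} {Q Γ : Type} (M : DPDA α Q Γ)

/-- Reachability between instantaneous descriptions. -/
abbrev Reaches : Q × List α × List Γ → Q × List α × List Γ → Prop :=
  Relation.ReflTransGen M.Step

variable {M}

theorem Step.unique {c d e : Q × List α × List Γ} (hd : M.Step c d) (he : M.Step c e) : d = e := by
  cases hd with
  | eps h =>
    cases he with
    | eps h' => simp_all
    | read h' =>
      have := M.det _ _ (Option.ne_none_iff_exists'.2 ⟨_, h⟩)
      simp_all
  | read h =>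
    cases he with
    | eps h' =>
      have := M.det _ _ (Option.ne_none_iff_exists'.2 ⟨_, h'⟩)
      simp_all
    | read h' => simp_all

theorem reaches_total {c d e : Q × List α × List Γ} (hd : M.Reaches c d) (he : M.Reaches c e) :
    M.Reaches d e ∨ M.Reaches e d :=
  Relation.ReflTransGen.total_of_right_unique (fun _ _ _ h h' => h.unique h') hd he

theorem eq_of_reaches_of_forall_not_step {c d : Q × List α × List Γ} (hc : ∀ e, ¬ M.Step c e)
    (h : M.Reaches c d) : d = c := by
  rcases h.cases_head with rfl | ⟨e, he, -⟩
  · rfl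
  · exact absurd he (hc e)

theorem not_step_nil (q : Q) (u : List α) (e : Q × List α × List Γ) : ¬ M.Step (q, u, []) e := by
  rintro ⟨⟩

theorem Step.frame {c d : Q × List α × List Γ} (h : M.Step c d) (w : List α) (t : List Γ) :
    M.Step (c.1, c.2.1 ++ w, c.2.2 ++ t) (d.1, d.2.1 ++ w, d.2.2 ++ t) := by
  cases h with
  | eps h => simpa using Step.eps h
  | read h => simpa using Step.read h

theorem Reaches.frame {p q : Q} {u v : List α} {g h : List Γ} (hr : M.Reaches (p, u, g) (q, v, h))
    (w : List α) (t : List Γ) : M.Reaches (p, u ++ w, g ++ t) (q, v ++ w, h ++ t) :=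
  Relation.ReflTransGen.lift (fun c : Q × List α × List Γ => (c.1, c.2.1 ++ w, c.2.2 ++ t))
    (fun _ _ h => h.frame w t) _ _ hr

theorem Reaches.exists_prefix {c d : Q × List α × List Γ} (hr : M.Reaches c d) :
    ∃ u, c.2.1 = u ++ d.2.1 ∧ M.Reaches (c.1, u, c.2.2) (d.1, [], d.2.2) := by
  induction hr using Relation.ReflTransGen.head_induction_on with
  | refl => exact ⟨[], rfl, .refl⟩
  | head hs _ ih =>
    obtain ⟨u, hu, hr⟩ := ih
    cases hs with
    | eps h => exact ⟨u, hu, .head (.eps h) hr⟩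
    | @read q p a w Z g s h => exact ⟨a :: u, by simpa using hu, .head (.read h) hr⟩

/-- A run on a stack `g₁ ++ g₂` either leaves `g₂` untouched or pops `g₁` first. -/
theorem Reaches.split {s : Q} {u : List α} {g₁ g₂ : List Γ} {d : Q × List α × List Γ}
    (hr : M.Reaches (s, u, g₁ ++ g₂) d) :
    (∃ h, h ≠ [] ∧ d.2.2 = h ++ g₂ ∧ M.Reaches (s, u, g₁) (d.1, d.2.1, h)) ∨
    ∃ p v, M.Reaches (s, u, g₁) (p, v, []) ∧ M.Reaches (p, v, g₂) d := by
  induction hr with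
  | refl =>
    rcases eq_or_ne g₁ [] with rfl | hg
    · exact Or.inr ⟨s, u, .refl, .refl⟩
    · exact Or.inl ⟨g₁, hg, rfl, .refl⟩
  | @tail c d _ hs ih =>
    rcases ih with ⟨h, hne, hc, hr⟩ | ⟨p, v, hr, hr'⟩
    · suffices ∃ h', d.2.2 = h' ++ g₂ ∧ M.Reaches (s, u, g₁) (d.1, d.2.1, h') by
        obtain ⟨h', hd, hr'⟩ := this
        rcases eq_or_ne h' [] with rfl | hh
        · refine Or.inr ⟨_, _, hr', ?_⟩
          rw [List.nil_append] at hd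
          rw [← hd]
        · exact Or.inl ⟨h', hh, hd, hr'⟩
      obtain ⟨Z, h, rfl⟩ := List.exists_cons_of_ne_nil hne
      cases hs with
      | eps hδ =>
        simp only [List.cons_append, List.cons.injEq] at hc
        obtain ⟨rfl, rfl⟩ := hc
        exact ⟨_ ++ h, by simp, hr.tail (.eps hδ)⟩
      | read hδ =>
        simp only [List.cons_append, List.cons.injEq] at hc
        obtain ⟨rfl, rfl⟩ := hc
        exact ⟨_ ++ h, by simp, hr.tail (.read hδ)⟩
    · exact Or.inr ⟨p, v, hr, hr'.tail hs⟩

/-! ### Observable behaviour of a run -/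

variable (M)

/-- The word `u` is accepted from the state `s` with the stack `g`. -/
def Accepts (s : Q) (g : List Γ) (u : List α) : Prop :=
  ∃ p ∈ M.accept, ∃ h, M.Reaches (s, u, g) (p, [], h)

/-- The states in which the stack is empty after the whole of `u` has been read. -/
def pops (s : Q) (g : List Γ) (u : List α) : Set Q :=
  {p | M.Reaches (s, u, g) (p, [], [])}

/-- The stack becomes empty at some moment of the run on `u`. -/
def Empties (s : Q) (g : List Γ) (u : List α) : Prop :=
  ∃ p v, M.Reaches (s, u, g) (p, v, [])

/-- What can be observed of the run on `u` from the state `s` with the stack `g`. -/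
def behaviour (s : Q) (g : List Γ) (u : List α) : Set Q × Prop × Prop :=
  (M.pops s g u, M.Accepts s g u, M.Empties s g u)

variable {M}

theorem behaviour_eq_iff {s s' : Q} {g g' : List Γ} {u u' : List α} :
    M.behaviour s g u = M.behaviour s' g' u' ↔ M.pops s g u = M.pops s' g' u' ∧
      (M.Accepts s g u ↔ M.Accepts s' g' u') ∧ (M.Empties s g u ↔ M.Empties s' g' u') := by
  simp [behaviour]

/-- By determinism, every configuration with exhausted input lies beyond the given one. This needs
`u' ≠ []`: otherwise earlier configurations might already accept. -/
theorem behaviour_eq_of_reaches {s s' : Q} {g g' : List Γ} {u u' : List α} (hu' : u' ≠ [])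
    (hr : M.Reaches (s, u, g) (s', u', g')) : M.behaviour s g u = M.behaviour s' g' u' := by
  have key : ∀ p h, M.Reaches (s, u, g) (p, [], h) ↔ M.Reaches (s', u', g') (p, [], h) := by
    intro p h
    refine ⟨fun hp => (reaches_total hr hp).resolve_right fun hp' => ?_, hr.trans⟩
    obtain ⟨w, hw, -⟩ := hp'.exists_prefix
    exact hu' (List.append_eq_nil_iff.1 hw.symm).2
  refine behaviour_eq_iff.2 ⟨Set.ext fun p => key p [], ?_, ?_⟩
  · exact exists_congr fun p => and_congr_right fun _ => exists_congr fun h => key p h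
  · refine exists_congr fun p => exists_congr fun v => ⟨fun hp => ?_, hr.trans⟩
    rcases reaches_total hr hp with h | h
    · exact h
    · rw [eq_of_reaches_of_forall_not_step (not_step_nil _ _) h]

theorem behaviour_of_forall_not_step {s : Q} {g : List Γ} {u : List α} (hu : u ≠ [])
    (h : ∀ e, ¬ M.Step (s, u, g) e) : M.behaviour s g u = (∅, False, g = []) := by
  have key : ∀ d, M.Reaches (s, u, g) d ↔ d = (s, u, g) := fun d =>
    ⟨eq_of_reaches_of_forall_not_step h, fun h => h ▸ .refl⟩
  simp [behaviour, pops, Accepts, Empties, key, hu.symm, eq_comm (a := ([] : List Γ))]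

/-- Acceptance may occur before `g₁` is gone or during the later moves on the empty word, hence the
disjunction. -/
theorem behaviour_append_of_pops {s p : Q} {g₁ g₂ : List Γ} {u : List α}
    (hp : p ∈ M.pops s g₁ u) : M.behaviour s (g₁ ++ g₂) u =
      (M.pops p g₂ [], M.Accepts s g₁ u ∨ M.Accepts p g₂ [], M.Empties p g₂ []) := by
  have hr : M.Reaches (s, u, g₁ ++ g₂) (p, [], g₂) := by
    simpa using Reaches.frame hp [] g₂
  have huniq : ∀ q v, M.Reaches (s, u, g₁) (q, v, []) → q = p ∧ v = [] := by
    intro q v hq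
    rcases reaches_total hp hq with h | h
    all_goals
      have := eq_of_reaches_of_forall_not_step (not_step_nil _ _) h
      simp_all
  have key : ∀ d : Q × List α × List Γ, M.Reaches (s, u, g₁ ++ g₂) d →
      (∃ h, h ≠ [] ∧ d.2.2 = h ++ g₂ ∧ M.Reaches (s, u, g₁) (d.1, d.2.1, h)) ∨
        M.Reaches (p, [], g₂) d := by
    intro d hd
    rcases hd.split with h | ⟨q, v, hq, hd⟩
    · exact Or.inl h
    · obtain ⟨rfl, rfl⟩ := huniq q v hq
      exact Or.inr hd
  have hempty : ∀ q v, M.Reaches (s, u, g₁ ++ g₂) (q, v, []) ↔ M.Reaches (p, [], g₂) (q, v, []) := by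
    refine fun q v => ⟨fun h => (key _ h).resolve_left ?_, hr.trans⟩
    rintro ⟨h', hne, hd, -⟩
    exact hne (List.append_eq_nil_iff.1 hd.symm).1
  simp only [behaviour, Prod.mk.injEq, eq_iff_iff]
  refine ⟨Set.ext fun q => hempty q [], ⟨?_, ?_⟩, ?_⟩
  · rintro ⟨q, hq, h, hd⟩
    rcases key _ hd with ⟨h', -, -, hd'⟩ | hd'
    · exact Or.inl ⟨q, hq, h', hd'⟩
    · exact Or.inr ⟨q, hq, h, hd'⟩
  · rintro (⟨q, hq, h, hd⟩ | ⟨q, hq, h, hd⟩)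
    · exact ⟨q, hq, h ++ g₂, by simpa using hd.frame [] g₂⟩
    · exact ⟨q, hq, h, hr.trans hd⟩
  · exact exists_congr fun q => exists_congr fun v => hempty q v

theorem behaviour_append_of_not_empties {s : Q} {g₁ g₂ : List Γ} {u : List α}
    (he : ¬ M.Empties s g₁ u) :
    M.behaviour s (g₁ ++ g₂) u = (∅, M.Accepts s g₁ u, False) := by
  have key : ∀ d : Q × List α × List Γ, M.Reaches (s, u, g₁ ++ g₂) d →
      (∃ h, h ≠ [] ∧ d.2.2 = h ++ g₂ ∧ M.Reaches (s, u, g₁) (d.1, d.2.1, h)) := by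
    intro d hd
    rcases hd.split with h | ⟨q, v, hq, hd⟩
    · exact h
    · exact absurd ⟨q, v, hq⟩ he
  have hempty : ∀ q v, ¬ M.Reaches (s, u, g₁ ++ g₂) (q, v, []) := by
    intro q v h
    obtain ⟨h', hne, hd, -⟩ := key _ h
    exact hne (List.append_eq_nil_iff.1 hd.symm).1
  simp only [behaviour, Prod.mk.injEq, eq_iff_iff, iff_false]
  refine ⟨Set.eq_empty_of_forall_notMem fun q => hempty q [], ⟨?_, ?_⟩, ?_⟩
  · rintro ⟨q, hq, h, hd⟩
    obtain ⟨h', -, -, hd'⟩ := key _ hd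
    exact ⟨q, hq, h', hd'⟩
  · rintro ⟨q, hq, h, hd⟩
    exact ⟨q, hq, h ++ g₂, by simpa using hd.frame [] g₂⟩
  · rintro ⟨q, v, h⟩
    exact hempty q v h

variable (M) in
/-- After at most `n` moves on the empty word no further such move is possible. -/
inductive EpsHalts : ℕ → Q → List Γ → Prop
  | halt {n : ℕ} {s : Q} {g : List Γ} (h : ∀ Z ∈ g.head?, M.δ s none Z = none) : EpsHalts n s g
  | step {n : ℕ} {s p : Q} {Z : Γ} {h g : List Γ} (hδ : M.δ s none Z = some (p, h))
      (hh : EpsHalts n p (h ++ g)) : EpsHalts (n + 1) s (Z :: g)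

theorem EpsHalts.succ {n : ℕ} {s : Q} {g : List Γ} (h : M.EpsHalts n s g) :
    M.EpsHalts (n + 1) s g := by
  induction h with
  | halt h => exact .halt h
  | step hδ _ ih => exact .step hδ ih

theorem EpsHalts.of_append {n : ℕ} {s : Q} {g₁ g₂ : List Γ} (h : M.EpsHalts n s (g₁ ++ g₂)) :
    M.EpsHalts n s g₁ := by
  generalize hg : g₁ ++ g₂ = g at h
  induction h generalizing g₁ with
  | halt h =>
    subst hg
    cases g₁ with
    | nil => exact .halt (by simp)
    | cons Z g₁ => exact .halt h
  | step hδ _ ih =>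
    cases g₁ with
    | nil => exact .halt (by simp)
    | cons Z g₁ =>
      simp only [List.cons_append, List.cons.injEq] at hg
      obtain ⟨rfl, rfl⟩ := hg
      exact .step hδ (ih (by simp))

theorem EpsHalts.of_reaches {n : ℕ} {c d : Q × List α × List Γ} (hr : M.Reaches c d)
    (hc : c.2.1 = []) (h : M.EpsHalts n c.1 c.2.2) : M.EpsHalts n d.1 d.2.2 := by
  induction hr using Relation.ReflTransGen.head_induction_on generalizing n with
  | refl => exact h
  | head hs _ ih =>
    cases hs with
    | eps hδ =>
      cases h with
      | halt h => simp [hδ] at h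
      | step hδ' h =>
        rw [hδ, Option.some.injEq, Prod.mk.injEq] at hδ'
        obtain ⟨rfl, rfl⟩ := hδ'
        exact (ih hc h).succ
    | read hδ => simp at hc

/-- An endless run of moves on the empty word never reads a letter and never empties the stack. -/
theorem behaviour_of_not_epsHalts {s : Q} {g : List Γ} {u : List α} (hu : u ≠ [])
    (h : ∀ n, ¬ M.EpsHalts n s g) : M.behaviour s g u = (∅, False, False) := by
  have key : ∀ d, M.Reaches (s, u, g) d → d.2.1 = u ∧ ∀ n, ¬ M.EpsHalts n d.1 d.2.2 := by
    intro d hd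
    induction hd with
    | refl => exact ⟨rfl, h⟩
    | tail _ hs ih =>
      obtain ⟨hc, hn⟩ := ih
      cases hs with
      | eps hδ => exact ⟨hc, fun n hh => hn (n + 1) (.step hδ hh)⟩
      | read hδ =>
        refine absurd (EpsHalts.halt (n := 0) ?_) (hn 0)
        intro Z hZ
        simp only [List.head?_cons, Option.mem_def, Option.some.injEq] at hZ
        subst hZ
        by_contra hne
        simp [M.det _ _ hne] at hδ
  have h₁ : ∀ p w, ¬ M.Reaches (s, u, g) (p, [], w) := fun p w hr => hu (key _ hr).1.symm
  have h₂ : ∀ p v, ¬ M.Reaches (s, u, g) (p, v, []) := fun p v hr =>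
    (key _ hr).2 0 (.halt (by simp))
  simp [behaviour, pops, Accepts, Empties, h₁, h₂]

variable (M) in
/-- The words with a given behaviour. -/
def node (s : Q) (g : List Γ) (β : Set Q × Prop × Prop) : Set (List α) :=
  {u | M.behaviour s g u = β}

end DPDA

theorem splits_univ {α : Type u} {V : Set (Set (List α))} (huniv : Set.univ ∈ V) (z : List α) :
    Splits V Set.univ z := by
  induction z with
  | nil => exact .short huniv trivial (by simp)
  | cons a z ih =>
    exact .append (z₁ := [a]) huniv (.short huniv trivial (by simp)) ih (by simp) (by simp)

namespace DPDA

variable {α : Type u} {Q Γ : Type} {M : DPDA α Q Γ} {V : Set (Set (List α))} {m : ℕ}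

/-- Equal length keeps an exchanged word nonempty, so a tree labelled `Set.univ` is fine enough. -/
theorem splits_of_const (huniv : Set.univ ∈ V) {s : Q} {g : List Γ} {u : List α}
    (hV : M.node s g (M.behaviour s g u) ∈ V) (hu : u ≠ []) {β : Set Q × Prop × Prop}
    (h : ∀ y : List α, y ≠ [] → M.behaviour s g y = β) :
    Splits V (M.node s g (M.behaviour s g u)) u := by
  refine .sub hV (splits_univ huniv u) fun y _ hy => (h y ?_).trans (h u hu).symm
  rintro rfl
  exact hu (List.length_eq_zero_iff.1 hy.symm)

/-- Follow one move: a move on the empty word lowers `n`, a reading move cuts off the first letter.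
-/
theorem splits_singleton (huniv : Set.univ ∈ V) (hsing : ∀ a : α, {[a]} ∈ V)
    (hnode : ∀ s g β, g.length ≤ m → M.node s g β ∈ V) (h1 : 1 ≤ m)
    (hm : ∀ q o Z p h, M.δ q o Z = some (p, h) → h.length ≤ m) {u : List α}
    (hu : 2 ≤ u.length)
    (ih : ∀ v : List α, v.length < u.length → ∀ s g, g.length ≤ m →
      Splits V (M.node s g (M.behaviour s g v)) v) {n : ℕ}
    (ihn : ∀ k < n, ∀ s g, g.length ≤ m → M.EpsHalts k s g →
      Splits V (M.node s g (M.behaviour s g u)) u) {s : Q} {Z : Γ} (hh : M.EpsHalts n s [Z]) :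
    Splits V (M.node s [Z] (M.behaviour s [Z] u)) u := by
  cases hh with
  | @step n _ p _ h _ hδ hh =>
    rw [List.append_nil] at hh
    have key : ∀ y : List α, y ≠ [] → M.behaviour s [Z] y = M.behaviour p h y := fun y hy =>
      behaviour_eq_of_reaches hy (.single (by simpa using Step.eps (s := []) hδ))
    refine .sub (hnode _ _ _ h1) (ihn n (by omega) p h (hm _ _ _ _ _ hδ) hh) fun y hy hl => ?_
    have hy0 : y ≠ [] := by rintro rfl; simp at hl; omega
    have hu0 : u ≠ [] := by rintro rfl; simp at hu
    exact (key y hy0).trans (hy.trans (key u hu0).symm)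
  | halt hh =>
    have hs : M.δ s none Z = none := hh Z (by simp)
    match u, hu with
    | a :: u, hu =>
    have hu0 : u ≠ [] := by rintro rfl; simp at hu
    have ha : Splits V {[a]} [a] := .short (hsing a) rfl (by simp)
    rcases hδ : M.δ s (some a) Z with _ | ⟨p, h⟩
    · have key : ∀ y : List α, M.behaviour s [Z] (a :: y) = (∅, False, [Z] = []) := by
        refine fun y => behaviour_of_forall_not_step (by simp) fun e he => ?_
        cases he with
        | eps h => simp [hs] at h
        | read h => simp [hδ] at h
      refine .append (z₁ := [a]) (hnode _ _ _ h1) ha (splits_univ huniv u) ?_ ?_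
      · rintro y rfl -
        exact rfl
      · exact fun y _ _ => (key y).trans (key u).symm
    · have key : ∀ y : List α, y ≠ [] → M.behaviour s [Z] (a :: y) = M.behaviour p h y :=
        fun y hy => behaviour_eq_of_reaches hy (.single (by simpa using Step.read (s := []) hδ))
      refine .append (z₁ := [a]) (hnode _ _ _ h1) ha (ih u (by simp) p h (hm _ _ _ _ _ hδ)) ?_ ?_
      · rintro y rfl -
        exact rfl
      · intro y hy hl
        have hy0 : y ≠ [] := by
          rintro rfl
          exact hu0 (List.length_eq_zero_iff.1 hl.symm)
        exact (key y hy0).trans (hy.trans (key u hu0).symm)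

/-- Cut `u` where the top symbol `Z` has been popped; the two factors then depend on `[Z]` and on
`g` separately. If `Z` is never popped, `g` is irrelevant. -/
theorem splits_of_epsHalts (huniv : Set.univ ∈ V)
    (hnode : ∀ s g β, g.length ≤ m → M.node s g β ∈ V) (h1 : 1 ≤ m) {u : List α}
    (hu : 2 ≤ u.length)
    (ih : ∀ v : List α, v.length < u.length → ∀ s g, g.length ≤ m →
      Splits V (M.node s g (M.behaviour s g v)) v) {n : ℕ}
    (hsingle : ∀ s Z, M.EpsHalts n s [Z] → Splits V (M.node s [Z] (M.behaviour s [Z] u)) u)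
    (g : List Γ) (s : Q) (hg : g.length ≤ m) (hh : M.EpsHalts n s g) :
    Splits V (M.node s g (M.behaviour s g u)) u := by
  have hu0 : u ≠ [] := by rintro rfl; simp at hu
  induction g generalizing s with
  | nil =>
    exact splits_of_const huniv (hnode _ _ _ hg) hu0 fun y hy =>
      behaviour_of_forall_not_step hy (not_step_nil s y)
  | cons Z g ihg =>
    have hg' : g.length ≤ m := by simp at hg; omega
    have hZ : M.EpsHalts n s [Z] := EpsHalts.of_append (g₁ := [Z]) (g₂ := g) hh
    by_cases he : M.Empties s [Z] u
    · obtain ⟨p, u₂, hr⟩ := he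
      obtain ⟨u₁, rfl, hr₁⟩ : ∃ u₁, u = u₁ ++ u₂ ∧ M.Reaches (s, u₁, [Z]) (p, [], []) :=
        hr.exists_prefix
      have hpop : ∀ y₁ y₂ : List α, p ∈ M.pops s [Z] y₁ → y₂ ≠ [] →
          M.behaviour s (Z :: g) (y₁ ++ y₂) = M.behaviour p g y₂ := fun y₁ y₂ hy₁ hy₂ =>
        behaviour_eq_of_reaches hy₂ (by simpa using Reaches.frame hy₁ y₂ g)
      rcases eq_or_ne u₂ [] with rfl | h₂
      · rw [List.append_nil] at *
        refine .sub (hnode _ _ _ hg) (hsingle s Z hZ) fun y hy hl => ?_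
        obtain ⟨e₁, e₂, e₃⟩ := behaviour_eq_iff.1 hy
        have hpy : p ∈ M.pops s [Z] y := e₁ ▸ hr₁
        refine (behaviour_append_of_pops (g₁ := [Z]) hpy).trans
          (.trans ?_ (behaviour_append_of_pops (g₁ := [Z]) hr₁).symm)
        rw [e₂]
      rcases eq_or_ne u₁ [] with rfl | h₁
      -- No input was used to pop `Z`, so the word does not shrink; the stack does.
      · rw [List.nil_append] at *
        have hh' : M.EpsHalts n p g :=
          EpsHalts.of_reaches (c := (s, [], Z :: g)) (d := (p, [], g))
            (by simpa using hr₁.frame [] g) rfl hh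
        refine .sub (hnode _ _ _ hg) (ihg p hg' hh') fun y hy hl => ?_
        have hy0 : y ≠ [] := by
          rintro rfl
          exact h₂ (List.length_eq_zero_iff.1 hl.symm)
        exact (hpop [] y hr₁ hy0).trans (hy.trans (hpop [] u₂ hr₁ h₂).symm)
      · have l₁ := List.length_pos_of_ne_nil h₁
        have l₂ := List.length_pos_of_ne_nil h₂
        refine .append (hnode _ _ _ hg) (ih u₁ (by simp; omega) s [Z] h1)
          (ih u₂ (by simp; omega) p g hg') ?_ ?_
        · intro y hy _
          obtain ⟨e₁, -⟩ := behaviour_eq_iff.1 hy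
          exact (hpop y u₂ (e₁ ▸ hr₁) h₂).trans (hpop u₁ u₂ hr₁ h₂).symm
        · intro y hy hl
          have hy0 : y ≠ [] := by
            rintro rfl
            exact h₂ (List.length_eq_zero_iff.1 hl.symm)
          exact (hpop u₁ y hr₁ hy0).trans (hy.trans (hpop u₁ u₂ hr₁ h₂).symm)
    · refine .sub (hnode _ _ _ hg) (hsingle s Z hZ) fun y hy hl => ?_
      -- Here the `Empties` component is essential: it ensures that `y` does not expose `g` either.
      obtain ⟨-, e₂, e₃⟩ := behaviour_eq_iff.1 hy
      refine (behaviour_append_of_not_empties (g₁ := [Z]) (e₃.not.2 he)).trans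
        (.trans ?_ (behaviour_append_of_not_empties (g₁ := [Z]) he).symm)
      rw [e₂]

/-- The induction is lexicographic: length of the word, then number of moves on the empty word, then
the stack. -/
theorem splits_behaviour (huniv : Set.univ ∈ V) (hsing : ∀ a : α, {[a]} ∈ V)
    (hnode : ∀ s g β, g.length ≤ m → M.node s g β ∈ V) (h1 : 1 ≤ m)
    (hm : ∀ q o Z p h, M.δ q o Z = some (p, h) → h.length ≤ m) (u : List α) (s : Q) (g : List Γ)
    (hg : g.length ≤ m) : Splits V (M.node s g (M.behaviour s g u)) u := by
  induction hl : u.length using Nat.strong_induction_on generalizing u s g with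
  | _ l ih =>
    subst hl
    rcases Nat.lt_or_ge u.length 2 with hu | hu
    · exact .short (hnode _ _ _ hg) rfl (by omega)
    have ih' : ∀ v : List α, v.length < u.length → ∀ s g, g.length ≤ m →
      Splits V (M.node s g (M.behaviour s g v)) v := fun v hv s g hg => ih _ hv v s g hg rfl
    by_cases hh : ∃ n, M.EpsHalts n s g
    · obtain ⟨n, hh⟩ := hh
      clear ih
      induction n using Nat.strong_induction_on generalizing s g with
      | _ n ihn =>
        exact splits_of_epsHalts huniv hnode h1 hu ih' (fun s Z hZ =>
          splits_singleton huniv hsing hnode h1 hm hu ih'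
            (fun k hk s g hg hh => ihn k hk s g hg hh) hZ) g s hg hh
    · push Not at hh
      have hu0 : u ≠ [] := by rintro rfl; simp at hu
      exact splits_of_const huniv (hnode _ _ _ hg) hu0 fun y hy => behaviour_of_not_epsHalts hy hh

theorem exists_finite_splits [Finite α] [Finite Q] [Finite Γ] (M : DPDA α Q Γ) :
    ∃ V : Set (Set (List α)), V.Finite ∧ ∀ u : List α,
      Splits V (M.node M.start [M.bottom] (M.behaviour M.start [M.bottom] u)) u := by
  obtain ⟨m, hm⟩ := Finite.exists_le
    (fun x : Q × Option α × Γ => (M.δ x.1 x.2.1 x.2.2).elim 0 fun y => y.2.length)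
  have hfin := List.finite_length_le Γ (m + 1)
  refine ⟨insert Set.univ (Set.range (fun a : α => ({[a]} : Set (List α))) ∪
      Set.image2 (fun g x => M.node x.1 g x.2) {g : List Γ | g.length ≤ m + 1}
        (Set.univ : Set (Q × Set Q × Prop × Prop))),
    ((Set.finite_range _).union (hfin.image2 _ Set.finite_univ)).insert _, fun u => ?_⟩
  -- The extra 1 makes room for one-symbol stacks even if all moves only pop.
  refine splits_behaviour (m := m + 1) (Set.mem_insert _ _)
    (fun a => Or.inr (Or.inl ⟨a, rfl⟩))
    (fun s g β hg => Or.inr (Or.inr ⟨g, hg, (s, β), trivial, rfl⟩)) (by omega) ?_ u _ _ (by simp)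
  intro q o Z p h hδ
  have := hm (q, o, Z)
  simp only [hδ, Option.elim_some] at this
  omega

end DPDA

/-- Acceptance is part of the behaviour, so the same trees serve accepted and rejected words. -/
theorem IsDCF.isSplittable {α : Type u} [Finite α] {L : Language α} (hL : IsDCF L) :
    IsSplittable L ∧ IsSplittable Lᶜ := by
  obtain ⟨Q, Γ, _, _, M, rfl⟩ := hL
  obtain ⟨V, hV, hM⟩ := M.exists_finite_splits
  constructor
  · refine ⟨insert _ V, hV.insert _, fun z hz => .sub (Set.mem_insert _ _)
      ((hM z).mono (Set.subset_insert _ _)) fun y hy _ => ?_⟩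
    exact (DPDA.behaviour_eq_iff.1 hy).2.1.2 hz
  · refine ⟨insert _ V, hV.insert _, fun z hz => .sub (Set.mem_insert _ _)
      ((hM z).mono (Set.subset_insert _ _)) fun y hy _ => ?_⟩
    exact fun hy' => hz ((DPDA.behaviour_eq_iff.1 hy).2.1.1 hy')

/-! ### Boolean combinations -/

theorem IsDCF.bot {α : Type u} : IsDCF (⊥ : Language α) := by
  refine ⟨Unit, Unit, inferInstance, inferInstance,
    ⟨fun _ _ _ => none, fun _ _ h => absurd rfl h, (), (), ∅⟩, ?_⟩
  ext w
  exact ⟨fun ⟨p, hp, _⟩ => hp, fun h => absurd h (Set.notMem_empty w)⟩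

/-- The languages that are, together with their complements, finite intersections of splittable
languages. -/
def interSplittable (α : Type u) : BooleanSubalgebra (Language α) where
  carrier := {L | L ∈ infClosure {K : Language α | IsSplittable K} ∧
    Lᶜ ∈ infClosure {K : Language α | IsSplittable K}}
  supClosed' := by
    rintro L ⟨hL, hL'⟩ M ⟨hM, hM'⟩
    have hsup : SupClosed {K : Language α | IsSplittable K} := fun _ h _ h' => h.sup h'
    refine ⟨hsup.infClosure hL hM, ?_⟩
    rw [compl_sup]
    exact infClosed_infClosure hL' hM'
  infClosed' := by
    rintro L ⟨hL, hL'⟩ M ⟨hM, hM'⟩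
    have hsup : SupClosed {K : Language α | IsSplittable K} := fun _ h _ h' => h.sup h'
    refine ⟨infClosed_infClosure hL hM, ?_⟩
    rw [compl_inf]
    exact hsup.infClosure hL' hM'
  compl_mem' := by
    rintro L ⟨hL, hL'⟩
    exact ⟨hL', by rwa [compl_compl]⟩
  bot_mem' := by
    have h : IsSplittable (⊥ : Language α) := ⟨∅, Set.finite_empty, fun z hz => absurd hz id⟩
    have h' : IsSplittable (⊤ : Language α) :=
      ⟨{Set.univ}, Set.finite_singleton _, fun z _ => splits_univ (Set.mem_singleton _) z⟩
    refine ⟨subset_infClosure h, ?_⟩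
    rw [compl_bot]
    exact subset_infClosure h'

theorem closure_isDCF_le_interSplittable {α : Type u} [Finite α] :
    BooleanSubalgebra.closure {K : Language α | IsDCF K} ≤ interSplittable α :=
  BooleanSubalgebra.closure_le.2 fun _ hK =>
    ⟨subset_infClosure hK.isSplittable.1, subset_infClosure hK.isSplittable.2⟩

theorem copyLang_notMem_closure_isDCF {α : Type u} [Finite α] {a b c : α} (hab : a ≠ b) :
    copyLang a b c ∉ BooleanSubalgebra.closure {K : Language α | IsDCF K} :=
  fun h => copyLang_notMem_infClosure hab (closure_isDCF_le_interSplittable h).1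

theorem copyLang_notMem_infClosure_isContextFree {α : Type u} {a b c : α} (hab : a ≠ b) :
    copyLang a b c ∉ infClosure {K : Language α | K.IsContextFree} := fun h =>
  copyLang_notMem_infClosure hab
    (infClosure_mono (fun _ hK => IsContextFree.isSplittable hK) h)

/-! ### Formulas of `theoryCF` and the Boolean closure -/

/-- The values of `x` that satisfy `f` when the other variables are given by `h`. -/
def Formula.slice {α : Type u} (f : Formula α) (x : ℕ) (h : ℕ → List α) : Language α :=
  {w | f.Holds (Function.update h x w)}

theorem Formula.mem_expressed_iff {α : Type u} {f : Formula α} {x : ℕ} {w : List α} :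
    w ∈ f.expressed x ↔ ∃ h, w ∈ f.slice x h := by
  constructor
  · rintro ⟨h, rfl, hf⟩
    refine ⟨h, ?_⟩
    change f.Holds _
    rwa [Function.update_eq_self]
  · rintro ⟨h, hf⟩
    exact ⟨_, Function.update_self x w h, hf⟩

/-- A basic term contains at most one variable, so an atom gives a fixed language in `x` or a truth
value; connectives preserve finiteness of the range. -/
theorem Formula.slices_of_mem_theoryCF {α : Type u} {f : Formula α} (hf : f ∈ theoryCF α) (x : ℕ) :
    (Set.range (f.slice x)).Finite ∧
      ∀ h, f.slice x h ∈ BooleanSubalgebra.closure {K : Language α | IsDCF K} := by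
  set B := BooleanSubalgebra.closure {K : Language α | IsDCF K} with hB
  have binary : ∀ {f g k : Formula α} (F : Language α → Language α → Language α),
      (∀ K ∈ B, ∀ L ∈ B, F K L ∈ B) → (∀ h, k.slice x h = F (f.slice x h) (g.slice x h)) →
      ((Set.range (f.slice x)).Finite ∧ ∀ h, f.slice x h ∈ B) →
      ((Set.range (g.slice x)).Finite ∧ ∀ h, g.slice x h ∈ B) →
      (Set.range (k.slice x)).Finite ∧ ∀ h, k.slice x h ∈ B := by
    intro f g k F hF hk hf hg
    refine ⟨(hf.1.image2 F hg.1).subset ?_, fun h => hk h ▸ hF _ (hf.2 h) _ (hg.2 h)⟩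
    rintro _ ⟨h, rfl⟩
    exact ⟨_, ⟨h, rfl⟩, _, ⟨h, rfl⟩, (hk h).symm⟩
  have himp : ∀ K ∈ B, ∀ L ∈ B, Kᶜ ⊔ L ∈ B := fun K hK L hL => B.supClosed (B.compl_mem hK) hL
  induction f with
  | mem s D =>
    obtain ⟨hs, hD⟩ : s.IsBasic ∧ IsDCF D := hf
    have hconst : ∀ P : (ℕ → List α) → Prop, (∀ h, (Formula.mem s D).slice x h = {_w | P h}) →
        (Set.range ((Formula.mem s D).slice x)).Finite ∧
          ∀ h, (Formula.mem s D).slice x h ∈ B := by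
      intro P hP
      have hor : ∀ h, (Formula.mem s D).slice x h = ⊤ ∨ (Formula.mem s D).slice x h = ⊥ := by
        intro h
        rw [hP]
        by_cases hh : P h
        · left; ext w; exact ⟨fun _ => trivial, fun _ => hh⟩
        · right; ext w; exact ⟨fun h' => hh h', fun h' => absurd h' id⟩
      refine ⟨(Set.toFinite {⊤, ⊥}).subset ?_, fun h => ?_⟩
      · rintro _ ⟨h, rfl⟩
        exact hor h
      · rcases hor h with e | e <;> rw [e]
        · exact B.top_mem
        · exact B.bot_mem
    rcases hs with ⟨y, rfl⟩ | ⟨v, rfl⟩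
    · by_cases hxy : y = x
      · subst hxy
        have hslice : ∀ h, (Formula.mem [Sum.inl y] D).slice y h = D := by
          intro h
          ext w
          change List.flatMap _ _ ∈ D ↔ w ∈ D
          simp
        refine ⟨(Set.finite_singleton D).subset ?_, fun h => ?_⟩
        · rintro _ ⟨h, rfl⟩
          exact hslice h
        · rw [hslice]
          exact BooleanSubalgebra.subset_closure hD
      · refine hconst (fun h => h y ∈ D) fun h => ?_
        ext w
        change List.flatMap _ _ ∈ D ↔ h y ∈ D
        simp [Function.update_of_ne hxy]
    · refine hconst (fun _ => v ∈ D) fun h => ?_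
      ext w
      change List.flatMap _ _ ∈ D ↔ v ∈ D
      simp [List.flatMap_map]
  | eq s t => exact hf.elim
  | not f ih =>
    have := ih hf
    exact binary (f := f) (g := f) (fun K _ => Kᶜ) (fun K hK _ _ => B.compl_mem hK)
      (fun _ => rfl) this this
  | and f g ihf ihg =>
    exact binary (· ⊓ ·) (fun K hK L hL => B.infClosed hK hL) (fun _ => rfl) (ihf hf.1) (ihg hf.2)
  | or f g ihf ihg =>
    exact binary (· ⊔ ·) (fun K hK L hL => B.supClosed hK hL) (fun _ => rfl) (ihf hf.1) (ihg hf.2)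
  | imp f g ihf ihg =>
    refine binary (fun K L => Kᶜ ⊔ L) himp (fun h => ?_) (ihf hf.1) (ihg hf.2)
    ext w
    exact imp_iff_not_or
  | iff f g ihf ihg =>
    refine binary (fun K L => (Kᶜ ⊔ L) ⊓ (Lᶜ ⊔ K))
      (fun K hK L hL => B.infClosed (himp K hK L hL) (himp L hL K hK)) (fun h => ?_)
      (ihf hf.1) (ihg hf.2)
    ext w
    exact iff_iff_implies_and_implies.trans (and_congr imp_iff_not_or imp_iff_not_or)

theorem mem_closure_of_expressible {α : Type u} {L : Language α}
    (hL : Expressible (theoryCF α) L) :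
    L ∈ BooleanSubalgebra.closure {K : Language α | IsDCF K} := by
  obtain ⟨f, hf, x, -, rfl⟩ := hL
  obtain ⟨hfin, hmem⟩ := Formula.slices_of_mem_theoryCF hf x
  have hsup : f.expressed x = hfin.toFinset.sup id := by
    have : ∀ w, w ∈ hfin.toFinset.sup id ↔ ∃ K ∈ hfin.toFinset, w ∈ K := by
      intro w
      generalize hfin.toFinset = t
      classical
      induction t using Finset.induction_on with
      | empty => exact ⟨fun h => absurd h id, by simp⟩
      | insert K t _ ih =>
        rw [Finset.sup_insert]
        refine (or_congr (Iff.rfl (a := w ∈ K)) ih).trans ?_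
        simp
    ext w
    rw [this, Formula.mem_expressed_iff]
    simp
  rw [hsup]
  refine Finset.sup_induction (BooleanSubalgebra.bot_mem) (fun K hK L hL =>
    BooleanSubalgebra.supClosed _ hK hL) fun K hK => ?_
  obtain ⟨h, rfl⟩ := (Set.Finite.mem_toFinset hfin).1 hK
  exact hmem h

theorem expressible_of_mem_closure {α : Type u} {L : Language α}
    (hL : L ∈ BooleanSubalgebra.closure {K : Language α | IsDCF K}) :
    Expressible (theoryCF α) L := by
  -- Equivalence under every assignment, unlike mere expressibility, passes through negation.
  suffices ∃ f ∈ theoryCF α, f.Occurs 0 ∧ ∀ h, f.Holds h ↔ h 0 ∈ L by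
    obtain ⟨f, hf, hocc, hL⟩ := this
    refine ⟨f, hf, 0, hocc, ?_⟩
    ext w
    constructor
    · rintro ⟨h, rfl, hh⟩
      exact (hL h).1 hh
    · exact fun hw => ⟨fun _ => w, rfl, (hL _).2 hw⟩
  have hmem : ∀ K : Language α, IsDCF K →
      ∃ f ∈ theoryCF α, f.Occurs 0 ∧ ∀ h, f.Holds h ↔ h 0 ∈ K := fun K hK =>
    ⟨.mem [Sum.inl 0] K, ⟨Or.inl ⟨0, rfl⟩, hK⟩, List.mem_singleton.2 rfl, fun h => by
      simp [Formula.Holds, StrTerm.eval]⟩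
  induction hL using BooleanSubalgebra.closure_bot_sup_induction with
  | mem K hK => exact hmem K hK
  | bot => exact hmem ⊥ .bot
  | sup K _ L _ ihK ihL =>
    obtain ⟨f, hf, hocc, hK⟩ := ihK
    obtain ⟨g, hg, -, hL⟩ := ihL
    exact ⟨.or f g, ⟨hf, hg⟩, Or.inl hocc, fun h => or_congr (hK h) (hL h)⟩
  | compl K _ ih =>
    obtain ⟨f, hf, hocc, hK⟩ := ih
    exact ⟨.not f, hf, hocc, fun h => not_congr (hK h)⟩

/-! ### The copy language is definable by a word equation -/

/-- An automaton for the words over the letters `a` and `b`. -/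
def lettersDFA {α : Type u} (a b : α) : DFA α Prop where
  -- The state records whether all letters so far were allowed; `Prop` serves as a two-element state
  -- set.
  step q s := q ∧ (s = a ∨ s = b)
  start := True
  accept := {q | q}

theorem mem_accepts_lettersDFA {α : Type u} (a b : α) (w : List α) :
    w ∈ (lettersDFA a b).accepts ↔ ∀ s ∈ w, s = a ∨ s = b := by
  have key : ∀ q : Prop, (lettersDFA a b).evalFrom q w ↔ q ∧ ∀ s ∈ w, s = a ∨ s = b := by
    induction w with
    | nil => simp
    | cons t w ih =>
      intro q
      rw [DFA.evalFrom_cons, ih]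
      simp [lettersDFA, and_assoc]
  exact (key True).trans (iff_of_eq (true_and _))

theorem expressible_copyLang {α : Type u} (a b c : α) :
    Expressible (theoryWEREG α) (copyLang a b c) := by
  refine ⟨.and (.eq [Sum.inl 0] [Sum.inl 1, Sum.inr c, Sum.inl 1])
    (.mem [Sum.inl 1] (lettersDFA a b).accepts),
    ⟨trivial, Prop, inferInstance, _, rfl⟩, 0, Or.inl (Or.inl (List.mem_singleton.2 rfl)), ?_⟩
  ext v
  have key : ∀ h : ℕ → List α, (Formula.and (.eq [Sum.inl 0] [Sum.inl 1, Sum.inr c, Sum.inl 1])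
      (.mem [Sum.inl 1] (lettersDFA a b).accepts)).Holds h ↔
      h 0 = h 1 ++ [c] ++ h 1 ∧ ∀ s ∈ h 1, s = a ∨ s = b := by
    intro h
    simp [Formula.Holds, StrTerm.eval, mem_accepts_lettersDFA]
  constructor
  · rintro ⟨h, rfl, hh⟩
    obtain ⟨h₀, h₁⟩ := (key h).1 hh
    exact ⟨h 1, h₁, h₀⟩
  · rintro ⟨w, hw, rfl⟩
    exact ⟨fun i => if i = 0 then w ++ [c] ++ w else w, rfl, (key _).2 ⟨rfl, hw⟩⟩

end StringLogic

theorem mainTheorem11 {α : Type*} [Finite α] :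
    (∀ a b c : α, a ≠ b → a ≠ c → b ≠ c →
      StringLogic.Expressible (StringLogic.theoryWEREG α) (StringLogic.copyLang a b c) ∧
      ¬ StringLogic.Expressible (StringLogic.theoryCF α) (StringLogic.copyLang a b c) ∧
      StringLogic.copyLang a b c ∉ infClosure {K : Language α | K.IsContextFree}) ∧
    ∀ L : Language α, StringLogic.Expressible (StringLogic.theoryCF α) L ↔
      L ∈ BooleanSubalgebra.closure {K : Language α | StringLogic.IsDCF K} :=
  ⟨fun a b c hab _ _ => ⟨StringLogic.expressible_copyLang a b c,
    fun h => StringLogic.copyLang_notMem_closure_isDCF hab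
      (StringLogic.mem_closure_of_expressible h),
    StringLogic.copyLang_notMem_infClosure_isContextFree hab⟩,
    fun _ => ⟨StringLogic.mem_closure_of_expressible, StringLogic.expressible_of_mem_closure⟩⟩
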